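/- Let $n \ge 0$, $m\ge 1$ and $a,b\in\mathbb{R}^n$, and let $h:\{1,\dots,n\}\to[0,1]$ be a uniformly random hash function, i.e. the values $h(1),\dots,h(n)$ are independent and uniform on $[0,1]$; the same $h$ is used for $a$ and for $b$. The Priority Sampling sketch of $a$ with sketch size $m$ is $\mathcal{S}(a)=\{K_a,V_a,\tau_a\}$, where the rank of an index $i$ with $a_i\neq 0$ is $R_i=h(i)/a_i^2$, $\tau_a$ is the $(m+1)$-st smallest of these ranks (and $\tau_a=\infty$ if $a$ has fewer than $m+1$ non-zero entries), $K_a=\{i : a_i\ne 0,\ R_i<\tau_a\}$, and $V_a$ contains $a_i$ for all $i\in K_a$. The sketch $\mathcal{S}(b)$ is defined in the same way. From the two sketches one computes the estimate $$W=\sum_{i\in K_a\cap K_b}\frac{a_ib_i}{\min(1,\;a_i^2\tau_a,\;b_i^2\tau_b)}.$$ Let $\mathcal{I}=\{i: a_i\ne0 \text{ and } b_i\neq 0\}$, and let $a_{\mathcal{I}}, b_{\mathcal{I}}$ be the vectors $a,b$ restricted to the indices in $\mathcal{I}$ (zero elsewhere). Then $W$ is integrable with $$\mathbb{E}[W]=\langle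 a,b\rangle ,$$ and, if $m\geq 2$, $W$ is square-integrable with $$\operatorname{Var}[W]\le \frac{2}{m-1}\max\left(\|a_{\mathcal{I}}\|_2^2\|b\|_2^2,\ \|a\|_2^2\|b_{\mathcal{I}}\|_2^2\right).$$ Moreover, the numbers $|K_a|$ and $|K_b|$ of index/value pairs stored in the sketches always satisfy $|K_a|\le m$ and $|K_b|\le m$. If $a$ has at least $m$ non-zero entries, then $|K_a|=m$ almost surely; if $b$ has at least $m$ non-zero entries, then $|K_b|=m$ almost surely. -/

import Mathlib

open MeasureTheory ProbabilityTheory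
open scoped ENNReal

noncomputable section

namespace PrioritySampling

/-- The set of indices of the non-zero entries of a vector. -/
def support {n : ℕ} (a : EuclideanSpace ℝ (Fin n)) : Finset (Fin n) :=
  Finset.univ.filter fun i => a i ≠ 0

/-- The vector that agrees with `a` on the indices in `I` and is zero elsewhere. -/
def restrictTo {n : ℕ} (a : EuclideanSpace ℝ (Fin n)) (I : Finset (Fin n)) :
    EuclideanSpace ℝ (Fin n) :=
  WithLp.toLp 2 fun i => if i ∈ I then a i else 0

/-- The `k`-th smallest (for `k ≥ 1`) of the values `R i`, `i ∈ s`, counted with multiplicity: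
the least `t` such that at least `k` of the indices `i ∈ s` satisfy `R i ≤ t`.
It is `∞` (the infimum of the empty set) if `s` has fewer than `k` elements. -/
def kthSmallest {ι : Type*} (s : Finset ι) (R : ι → ℝ≥0∞) (k : ℕ) : ℝ≥0∞ :=
  sInf {t : ℝ≥0∞ | k ≤ (s.filter fun i => R i ≤ t).card}

/-- A sketch of a vector of length `n`: a set `K` of indices, the value stored for each index
in `K`, and a threshold `τ ∈ [0, ∞]`. -/
structure Sketch (n : ℕ) where
  /-- the stored indices -/
  K : Finset (Fin n)
  /-- the value stored with each of these indices -/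
  V : {i : Fin n // i ∈ K} → ℝ
  /-- the threshold -/
  τ : ℝ≥0∞

/-- The number of index/value pairs stored in a sketch. -/
def Sketch.size {n : ℕ} (S : Sketch n) : ℕ := S.K.card

/-- The rank `h(i) / a_i²` of index `i` (used only for `a_i ≠ 0`). -/
def rank {n : ℕ} (h : Fin n → unitInterval) (a : EuclideanSpace ℝ (Fin n)) (i : Fin n) : ℝ≥0∞ :=
  ENNReal.ofReal ((h i : ℝ) / a i ^ 2)

/-- The threshold: the `(m+1)`-st smallest rank among the non-zero entries of `a`, and `∞` if
`a` has fewer than `m + 1` non-zero entries. -/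
def threshold {n : ℕ} (h : Fin n → unitInterval) (m : ℕ) (a : EuclideanSpace ℝ (Fin n)) : ℝ≥0∞ :=
  kthSmallest (support a) (rank h a) (m + 1)

/-- Priority Sampling with hash function `h` and sketch size `m`: keep the non-zero entries
of `a` whose rank is strictly below the threshold. -/
def sketch {n : ℕ} (h : Fin n → unitInterval) (m : ℕ) (a : EuclideanSpace ℝ (Fin n)) :
    Sketch n where
  K := (support a).filter fun i => rank h a i < threshold h m a
  V := fun i => a i
  τ := threshold h m a

/-- The inner product estimator. It sees the two sketches only. The minimum is taken in
`[0, ∞]`, since thresholds may be infinite; it is at most `1`, hence a real number. -/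
def estimate {n : ℕ} (S T : Sketch n) : ℝ :=
  ∑ i : {i : Fin n // i ∈ S.K ∩ T.K},
    let x : ℝ := S.V ⟨i, (Finset.mem_inter.mp i.2).1⟩
    let y : ℝ := T.V ⟨i, (Finset.mem_inter.mp i.2).2⟩
    x * y / (min 1 (min (ENNReal.ofReal (x ^ 2) * S.τ) (ENNReal.ofReal (y ^ 2) * T.τ))).toReal

end PrioritySampling

end

namespace PrioritySampling

/-! ### Order statistics and the effect of deleting indices -/

section OrderStatistics

variable {ι : Type*} {s : Finset ι} {R : ι → ℝ≥0∞} {k : ℕ} {t : ℝ≥0∞}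

/-! The estimate is an inverse-probability weighted sum, but its thresholds depend on the hash
values they are compared with. Leaving one out removes this: if `i` is kept, its threshold is the
`m`-th smallest rank among the other indices, a quantity free of `h i`. Integrating over `h i` first
therefore gives each weight mean 1 (`lintegral_mul_weight`, `weight_cap_succ`), which is
unbiasedness. Leaving out two indices gives each product of distinct weights mean 1, so the weights
are uncorrelated and the variance is a diagonal sum.

A squared weight has mean `E[1 / min (1, A, B)] ≤ 1 + E[1/A] + E[1/B]`, with `A` and `B` the
leave-one-out thresholds scaled by `a i ^ 2` and `b i ^ 2`. Inverse thresholds are bounded by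
unbiasedness again (`lintegral_inv_kthSmallest_le`): the weighted estimate of a squared norm has
that norm as its mean, yet is almost surely at least the number of kept indices times `1/τ`. -/

lemma kthSmallest_le (h : k ≤ (s.filter fun i => R i ≤ t).card) : kthSmallest s R k ≤ t :=
  sInf_le h

/-- The infimum cannot collapse onto `t`, because finitely many ranks leave a gap above `t`. -/
lemma lt_kthSmallest_iff (ht : t < ∞) :
    t < kthSmallest s R k ↔ (s.filter fun i => R i ≤ t).card < k := by
  constructor
  · intro h
    by_contra! hk
    exact absurd (kthSmallest_le hk) (not_le.mpr h)
  · intro h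
    -- The least rank above `t` (`∞` if there is none) bounds every admissible level from below.
    have hlt : t < (s.filter fun i => t < R i).inf R := by
      rw [Finset.lt_inf_iff ht]
      simp
    refine hlt.trans_le (le_sInf fun u hu => ?_)
    obtain ⟨j, hj, hj'⟩ := Finset.exists_mem_notMem_of_card_lt_card (h.trans_le hu)
    simp only [Finset.mem_filter, not_and, not_le] at hj hj'
    exact (Finset.inf_le (by simp [hj.1, hj' hj.1])).trans hj.2

lemma kthSmallest_le_iff (ht : t < ∞) :
    kthSmallest s R k ≤ t ↔ k ≤ (s.filter fun i => R i ≤ t).card := by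
  rw [← not_lt, lt_kthSmallest_iff ht, not_lt]

lemma eq_of_forall_lt_top_lt_iff {x y : ℝ≥0∞} (h : ∀ t < ∞, t < x ↔ t < y) : x = y := by
  refine le_antisymm (le_of_forall_lt fun t ht => ?_) (le_of_forall_lt fun t ht => ?_)
  · exact (h t (ht.trans_le le_top)).1 ht
  · exact (h t (ht.trans_le le_top)).2 ht

lemma kthSmallest_congr {R' : ι → ℝ≥0∞} (h : ∀ i ∈ s, R i = R' i) :
    kthSmallest s R k = kthSmallest s R' k := by
  have (t : ℝ≥0∞) : (s.filter fun i => R i ≤ t) = s.filter fun i => R' i ≤ t :=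
    Finset.filter_congr fun i hi => by rw [h i hi]
  simp only [kthSmallest, this]

lemma kthSmallest_pos (hk : 1 ≤ k) (h : ∀ i ∈ s, 0 < R i) : 0 < kthSmallest s R k := by
  rw [lt_kthSmallest_iff ENNReal.zero_lt_top, Finset.filter_false_of_mem]
  · rw [Finset.card_empty]
    omega
  · exact fun i hi => not_le.mpr (h i hi)

lemma kthSmallest_eq_top (h : s.card < k) : kthSmallest s R k = ∞ := by
  refine eq_of_forall_lt_top_lt_iff fun t ht => ?_
  rw [lt_kthSmallest_iff ht]
  simp [ht, (Finset.card_filter_le s _).trans_lt h]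

lemma card_lt_kthSmallest_le (s : Finset ι) (R : ι → ℝ≥0∞) (k : ℕ) :
    (s.filter fun i => R i < kthSmallest s R (k + 1)).card ≤ k := by
  set K := s.filter fun i => R i < kthSmallest s R (k + 1) with hK
  rcases K.eq_empty_or_nonempty with h | h
  · simp [h]
  obtain ⟨j, hj, hmax⟩ := K.exists_max_image R h
  have hj' := (Finset.mem_filter.1 hj).2
  have := (lt_kthSmallest_iff (hj'.trans_le le_top)).1 hj'
  refine (Finset.card_le_card fun i hi => ?_).trans (Nat.lt_succ_iff.1 this)
  exact Finset.mem_filter.2 ⟨(Finset.mem_filter.1 hi).1, hmax i hi⟩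

/-- Without ties, at most one of the `k + 1` or more ranks that are `≤ τ` equals `τ`. -/
lemma card_lt_kthSmallest_eq (hR : Set.InjOn R s) (hfin : ∀ i ∈ s, R i < ∞) (hk : k ≤ s.card) :
    (s.filter fun i => R i < kthSmallest s R (k + 1)).card = k := by
  classical
  refine le_antisymm (card_lt_kthSmallest_le s R k) ?_
  rcases eq_or_ne (kthSmallest s R (k + 1)) ∞ with h | h
  · rw [h, Finset.filter_true_of_mem hfin]
    exact hk
  · have h1 := (kthSmallest_le_iff (lt_top_iff_ne_top.2 h)).1 le_rfl
    set τ := kthSmallest s R (k + 1)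
    have h2 : (s.filter fun i => R i ≤ τ) =
        (s.filter fun i => R i < τ) ∪ s.filter fun i => R i = τ := by
      ext i
      simp only [Finset.mem_filter, Finset.mem_union, le_iff_lt_or_eq]
      tauto
    have h3 : (s.filter fun i => R i = τ).card ≤ 1 := by
      refine Finset.card_le_one.2 fun i hi j hj => ?_
      simp only [Finset.mem_filter] at hi hj
      exact hR hi.1 hj.1 (hi.2.trans hj.2.symm)
    have h4 := Finset.card_union_le (s.filter fun i => R i < τ) (s.filter fun i => R i = τ)
    rw [← h2] at h4
    omega

variable [DecidableEq ι]

lemma card_filter_erase_add_one {i : ι} (hi : i ∈ s) (h : R i ≤ t) :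
    ((s.erase i).filter fun j => R j ≤ t).card + 1 = (s.filter fun j => R j ≤ t).card := by
  rw [Finset.filter_erase, Finset.card_erase_add_one]
  exact Finset.mem_filter.2 ⟨hi, h⟩

/-- Deleting `i` lowers the count at level `R i` by exactly one. -/
lemma lt_kthSmallest_succ_iff {i : ι} (hi : i ∈ s) (hfin : R i < ∞) :
    R i < kthSmallest s R (k + 1) ↔ R i < kthSmallest (s.erase i) R k := by
  rw [lt_kthSmallest_iff hfin, lt_kthSmallest_iff hfin, ← card_filter_erase_add_one hi le_rfl]
  omega

lemma kthSmallest_succ_eq {i : ι} (hi : i ∈ s) (h : R i < kthSmallest s R (k + 1)) :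
    kthSmallest s R (k + 1) = kthSmallest (s.erase i) R k := by
  have hfin : R i < ∞ := h.trans_le le_top
  have h' := (lt_kthSmallest_succ_iff hi hfin).1 h
  refine eq_of_forall_lt_top_lt_iff fun t ht => ?_
  rcases le_or_gt (R i) t with hit | hit
  · rw [lt_kthSmallest_iff ht, lt_kthSmallest_iff ht, ← card_filter_erase_add_one hi hit]
    omega
  · exact ⟨fun _ => hit.trans h', fun _ => hit.trans h⟩

/-- Only the conjunction survives two deletions: if `j` is not kept, deleting it need not lower the
count at level `R i`. -/
lemma lt_kthSmallest_add_two_iff {i j : ι} (hi : i ∈ s) (hj : j ∈ s) (hij : i ≠ j)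
    (hfi : R i < ∞) (hfj : R j < ∞) :
    (R i < kthSmallest s R (k + 2) ∧ R j < kthSmallest s R (k + 2)) ↔
      (R i < kthSmallest ((s.erase i).erase j) R k ∧
        R j < kthSmallest ((s.erase i).erase j) R k) := by
  have hj' : j ∈ s.erase i := Finset.mem_erase.2 ⟨hij.symm, hj⟩
  constructor
  · rintro ⟨h1, h2⟩
    have e1 := kthSmallest_succ_eq hi h1
    rw [e1] at h1 h2
    have e2 := kthSmallest_succ_eq hj' h2
    rw [e2] at h1 h2
    exact ⟨h1, h2⟩
  · rintro ⟨h1, h2⟩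
    rw [← lt_kthSmallest_succ_iff hj' hfj] at h2
    rw [← kthSmallest_succ_eq hj' h2, ← lt_kthSmallest_succ_iff hi hfi] at h1
    rw [← kthSmallest_succ_eq hi h1] at h2
    exact ⟨h1, h2⟩

lemma kthSmallest_add_two_eq {i j : ι} (hi : i ∈ s) (hj : j ∈ s) (hij : i ≠ j)
    (h1 : R i < kthSmallest s R (k + 2)) (h2 : R j < kthSmallest s R (k + 2)) :
    kthSmallest s R (k + 2) = kthSmallest ((s.erase i).erase j) R k := by
  have e1 := kthSmallest_succ_eq hi h1
  rw [e1] at h2 ⊢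
  exact kthSmallest_succ_eq (Finset.mem_erase.2 ⟨hij.symm, hj⟩) h2

end OrderStatistics

/-! ### Measurability, and integrating out one hash value -/

lemma measurable_kthSmallest {ι X : Type*} [MeasurableSpace X] (s : Finset ι)
    {R : X → ι → ℝ≥0∞} (hR : ∀ i, Measurable fun x => R x i) (k : ℕ) :
    Measurable fun x => kthSmallest s (R x) k := by
  refine measurable_of_Ioi fun t => ?_
  rcases eq_or_ne t ∞ with rfl | ht
  · simp
  have h : Measurable fun x => ∑ i ∈ s, if R x i ≤ t then 1 else 0 :=
    Finset.measurable_sum _ fun i _ =>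
      Measurable.ite (measurableSet_le (hR i) measurable_const) measurable_const measurable_const
  have : (fun x => kthSmallest s (R x) k) ⁻¹' Set.Ioi t =
      (fun x => ∑ i ∈ s, if R x i ≤ t then 1 else 0) ⁻¹' Set.Iio k := by
    ext x
    simp only [Set.mem_preimage, Set.mem_Ioi, Set.mem_Iio,
      lt_kthSmallest_iff (lt_top_iff_ne_top.2 ht), Finset.card_filter]
  rw [this]
  exact h measurableSet_Iio

/-- The inverse of the probability that a uniform variable lies below `T`, on the event that
its value `u` does so. -/
noncomputable def weight (u T : ℝ≥0∞) : ℝ≥0∞ := if u < T then (min 1 T)⁻¹ else 0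

lemma weight_of_lt {u T : ℝ≥0∞} (h : u < T) : weight u T = (min 1 T)⁻¹ := if_pos h

lemma weight_of_not_lt {u T : ℝ≥0∞} (h : ¬ u < T) : weight u T = 0 := if_neg h

@[fun_prop]
lemma measurable_weight {X : Type*} [MeasurableSpace X] {u T : X → ℝ≥0∞}
    (hu : Measurable u) (hT : Measurable T) : Measurable fun x => weight (u x) (T x) :=
  Measurable.ite (measurableSet_lt hu hT) (measurable_const.min hT).inv measurable_const

lemma volume_ofReal_lt (T : ℝ≥0∞) :
    volume {t : unitInterval | ENNReal.ofReal t < T} = min 1 T := by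
  rcases lt_or_ge 1 T with h | h
  · rw [min_eq_left h.le]
    convert measure_univ (μ := (volume : Measure unitInterval))
    ext t
    simpa using (ENNReal.ofReal_le_one.2 t.2.2).trans_lt h
  · rw [min_eq_right h]
    have hT : T ≠ ∞ := (h.trans_lt ENNReal.one_lt_top).ne
    have h1 : T.toReal ≤ 1 := ENNReal.toReal_le_of_le_ofReal zero_le_one (by simpa using h)
    have : {t : unitInterval | ENNReal.ofReal t < T} =
        Set.Iio (⟨T.toReal, ENNReal.toReal_nonneg, h1⟩ : unitInterval) := by
      ext t
      rw [Set.mem_ofPred_eq, Set.mem_Iio, ← Subtype.coe_lt_coe,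
        ENNReal.ofReal_lt_iff_lt_toReal t.2.1 hT]
    rw [this, unitInterval.volume_Iio, ENNReal.ofReal_toReal hT]

lemma lintegral_weight {T : ℝ≥0∞} (hT : 0 < T) :
    ∫⁻ t : unitInterval, weight (ENNReal.ofReal t) T = 1 := by
  have hm : MeasurableSet {t : unitInterval | ENNReal.ofReal t < T} :=
    measurableSet_lt (by fun_prop) measurable_const
  have : (fun t : unitInterval => weight (ENNReal.ofReal t) T) =
      {t : unitInterval | ENNReal.ofReal t < T}.indicator fun _ => (min 1 T)⁻¹ := by
    ext t
    simp [weight, Set.indicator_apply]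
  rw [this, lintegral_indicator_const hm, volume_ofReal_lt]
  refine ENNReal.inv_mul_cancel ?_ ?_
  · simp [min_eq_iff, hT.ne']
  · exact (min_le_left _ _).trans_lt ENNReal.one_lt_top |>.ne

variable {n : ℕ}

/-- With the other coordinates fixed, `φ` and `T` are constants and the weight integrates to 1 over
coordinate `i`. -/
lemma lintegral_mul_weight (i : Fin n) {φ T : (Fin n → unitInterval) → ℝ≥0∞}
    (hφ : Measurable φ) (hT : Measurable T)
    (hφi : ∀ x t, φ (Function.update x i t) = φ x) (hTi : ∀ x t, T (Function.update x i t) = T x)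
    (hpos : ∀ᵐ x, 0 < T x) :
    ∫⁻ x, φ x * weight (ENNReal.ofReal (x i)) (T x) = ∫⁻ x, φ x := by
  -- Marginals must agree at every point, whereas `T` is positive only almost everywhere; the
  -- indicator covers `T = 0`.
  have h1 : ∫⁻ x, φ x * weight (ENNReal.ofReal (x i)) (T x) =
      ∫⁻ x, φ x * if 0 < T x then 1 else 0 := by
    rw [volume_pi]
    refine lintegral_eq_of_lmarginal_eq {i} (by fun_prop) ?_ ?_
    · exact hφ.mul (Measurable.ite (measurableSet_lt measurable_const hT)
        measurable_const measurable_const)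
    · rw [lmarginal_singleton, lmarginal_singleton]
      ext x
      simp only [hφi, hTi, Function.update_self]
      rw [lintegral_const_mul _ (by fun_prop)]
      split_ifs with h
      · simp [lintegral_weight h]
      · have : T x = 0 := by simpa using h
        simp [this, weight]
  rw [h1]
  refine lintegral_congr_ae ?_
  filter_upwards [hpos] with x hx
  simp [hx]

lemma ae_pos : ∀ᵐ x : Fin n → unitInterval, ∀ i, (0 : ℝ) < x i := by
  refine ae_all_iff.2 fun i => ?_
  have h : ∀ᵐ t : unitInterval, (0 : ℝ) < t := by
    filter_upwards [compl_mem_ae_iff.2 (measure_singleton (μ := volume) (0 : unitInterval))]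
      with t ht
    exact lt_of_le_of_ne t.2.1 fun h => ht (Subtype.ext h.symm)
  exact (Measure.quasiMeasurePreserving_eval
    (fun _ : Fin n => (volume : Measure unitInterval)) i).ae h

/-! ### Ranks of random hash values -/

lemma mem_support {a : EuclideanSpace ℝ (Fin n)} {i : Fin n} : i ∈ support a ↔ a i ≠ 0 := by
  simp [support]

lemma rank_lt_top (x : Fin n → unitInterval) (a : EuclideanSpace ℝ (Fin n)) (i : Fin n) :
    rank x a i < ∞ := ENNReal.ofReal_lt_top

lemma rank_lt_iff (x : Fin n → unitInterval) {a : EuclideanSpace ℝ (Fin n)} {i : Fin n}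
    (hi : a i ≠ 0) (τ : ℝ≥0∞) :
    rank x a i < τ ↔ ENNReal.ofReal (x i) < ENNReal.ofReal (a i ^ 2) * τ := by
  have h : 0 < a i ^ 2 := by positivity
  rw [rank, ENNReal.ofReal_div_of_pos h,
    ENNReal.div_lt_iff (Or.inl (ENNReal.ofReal_pos.2 h).ne') (Or.inl ENNReal.ofReal_ne_top),
    mul_comm]

@[fun_prop]
lemma measurable_rank (a : EuclideanSpace ℝ (Fin n)) (i : Fin n) :
    Measurable fun x : Fin n → unitInterval => rank x a i := by
  unfold rank
  fun_prop

lemma rank_update (x : Fin n → unitInterval) (a : EuclideanSpace ℝ (Fin n)) {i j : Fin n}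
    (h : j ≠ i) (t : unitInterval) : rank (Function.update x i t) a j = rank x a j := by
  simp [rank, h]

/-- With the other hash values fixed, at most one value of `x i` ties with a given `j`. -/
lemma ae_injOn_rank (a : EuclideanSpace ℝ (Fin n)) :
    ∀ᵐ x : Fin n → unitInterval, Set.InjOn (rank x a) (support a) := by
  have key (i j : Fin n) (hij : i ≠ j) (hi : a i ≠ 0) :
      ∀ᵐ x : Fin n → unitInterval, rank x a i ≠ rank x a j := by
    have hm : MeasurableSet {x : Fin n → unitInterval | rank x a i = rank x a j} :=
      measurableSet_eq_fun (by fun_prop) (by fun_prop)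
    rw [ae_iff]
    simp only [ne_eq, not_not]
    rw [← lintegral_indicator_one hm,
      ← lintegral_zero (μ := (volume : Measure (Fin n → unitInterval))), volume_pi]
    refine lintegral_eq_of_lmarginal_eq {i} (measurable_one.indicator hm) measurable_const ?_
    rw [lmarginal_singleton, lmarginal_singleton]
    ext x
    rw [lintegral_zero]
    refine lintegral_eq_zero_of_ae_eq_zero ?_
    have hs :
        {t : unitInterval | ENNReal.ofReal ((t : ℝ) / a i ^ 2) = rank x a j}.Subsingleton := by
      intro t ht t' ht'
      have h : 0 < a i ^ 2 := by positivity
      have e := ht.trans ht'.symm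
      rw [ENNReal.ofReal_eq_ofReal_iff (div_nonneg t.2.1 h.le) (div_nonneg t'.2.1 h.le),
        div_left_inj' h.ne'] at e
      exact Subtype.ext e
    filter_upwards [compl_mem_ae_iff.2 (hs.measure_zero volume)] with t ht
    rw [Set.indicator_of_notMem]
    · rfl
    · simp only [Set.mem_ofPred_eq, rank_update x a hij.symm]
      simpa [rank] using ht
  have : ∀ᵐ x : Fin n → unitInterval, ∀ i j, i ≠ j → a i ≠ 0 → rank x a i ≠ rank x a j := by
    simp only [ae_all_iff, Filter.eventually_imp_distrib_left]
    exact key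
  filter_upwards [this] with x hx i hi j _ e
  by_contra hij
  exact hx i j hij (mem_support.1 hi) e

/-- With the thresholds of index sets `s` and `t`, index `i` is kept in both sketches if its hash
value lies below this bound. -/
noncomputable def cap (a b : EuclideanSpace ℝ (Fin n)) (s t : Finset (Fin n)) (k : ℕ) (i : Fin n)
    (x : Fin n → unitInterval) : ℝ≥0∞ :=
  min (ENNReal.ofReal (a i ^ 2) * kthSmallest s (rank x a) k)
    (ENNReal.ofReal (b i ^ 2) * kthSmallest t (rank x b) k)

/-! ### Moments of the weights -/

section Cap

variable {a b : EuclideanSpace ℝ (Fin n)} {s t : Finset (Fin n)} {k : ℕ} {i j : Fin n}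

@[fun_prop]
lemma measurable_cap : Measurable (cap a b s t k i) :=
  ((measurable_kthSmallest s (measurable_rank a) k).const_mul _).min
    ((measurable_kthSmallest t (measurable_rank b) k).const_mul _)

lemma lt_cap_iff (hi : a i ≠ 0) (hi' : b i ≠ 0) (x : Fin n → unitInterval) :
    ENNReal.ofReal (x i) < cap a b s t k i x ↔
      rank x a i < kthSmallest s (rank x a) k ∧ rank x b i < kthSmallest t (rank x b) k := by
  rw [cap, lt_min_iff, rank_lt_iff x hi, rank_lt_iff x hi']

lemma cap_update (hs : j ∉ s) (ht : j ∉ t) (x : Fin n → unitInterval) (u : unitInterval) :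
    cap a b s t k i (Function.update x j u) = cap a b s t k i x := by
  unfold cap
  congr 2
  · exact kthSmallest_congr fun l hl => rank_update x a (ne_of_mem_of_not_mem hl hs) u
  · exact kthSmallest_congr fun l hl => rank_update x b (ne_of_mem_of_not_mem hl ht) u

lemma ae_cap_pos (hs : s ⊆ support a) (ht : t ⊆ support b) (hi : a i ≠ 0) (hi' : b i ≠ 0)
    (hk : 1 ≤ k) : ∀ᵐ x, 0 < cap a b s t k i x := by
  have hrank (c : EuclideanSpace ℝ (Fin n)) (r : Finset (Fin n)) (hr : r ⊆ support c)
      (hc : c i ≠ 0) (x : Fin n → unitInterval) (hx : ∀ j, (0 : ℝ) < x j) :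
      0 < ENNReal.ofReal (c i ^ 2) * kthSmallest r (rank x c) k := by
    refine ENNReal.mul_pos (by simpa [sq_pos_iff] using hc) (kthSmallest_pos hk fun j hj => ?_).ne'
    have := mem_support.1 (hr hj)
    exact ENNReal.ofReal_pos.2 (div_pos (hx j) (by positivity))
  filter_upwards [ae_pos] with x hx
  exact lt_min (hrank a s hs hi x hx) (hrank b t ht hi' x hx)

/-- The new cap does not involve `x i`: the caps agree when `i` is kept, and otherwise both weights
vanish. -/
lemma weight_cap_succ (hs : s ⊆ support a) (ht : t ⊆ support b) (hi : i ∈ s) (hi' : i ∈ t)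
    (x : Fin n → unitInterval) :
    weight (ENNReal.ofReal (x i)) (cap a b s t (k + 1) i x) =
      weight (ENNReal.ofReal (x i)) (cap a b (s.erase i) (t.erase i) k i x) := by
  have ha := mem_support.1 (hs hi)
  have hb := mem_support.1 (ht hi')
  have h : ENNReal.ofReal (x i) < cap a b s t (k + 1) i x ↔
      ENNReal.ofReal (x i) < cap a b (s.erase i) (t.erase i) k i x := by
    rw [lt_cap_iff ha hb, lt_cap_iff ha hb, lt_kthSmallest_succ_iff hi (rank_lt_top x a i),
      lt_kthSmallest_succ_iff hi' (rank_lt_top x b i)]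
  by_cases hlt : ENNReal.ofReal (x i) < cap a b s t (k + 1) i x
  · rw [weight_of_lt hlt, weight_of_lt (h.1 hlt)]
    rw [lt_cap_iff ha hb] at hlt
    rw [cap, cap, kthSmallest_succ_eq hi hlt.1, kthSmallest_succ_eq hi' hlt.2]
  · rw [weight_of_not_lt hlt, weight_of_not_lt (h.not.1 hlt)]

lemma weight_mul_weight_cap_add_two (hs : s ⊆ support a) (ht : t ⊆ support b)
    (hi : i ∈ s) (hi' : i ∈ t) (hj : j ∈ s) (hj' : j ∈ t) (hij : i ≠ j)
    (x : Fin n → unitInterval) :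
    weight (ENNReal.ofReal (x i)) (cap a b s t (k + 2) i x) *
        weight (ENNReal.ofReal (x j)) (cap a b s t (k + 2) j x) =
      weight (ENNReal.ofReal (x i))
          (cap a b ((s.erase i).erase j) ((t.erase i).erase j) k i x) *
        weight (ENNReal.ofReal (x j))
          (cap a b ((s.erase i).erase j) ((t.erase i).erase j) k j x) := by
  have hai := mem_support.1 (hs hi)
  have hbi := mem_support.1 (ht hi')
  have haj := mem_support.1 (hs hj)
  have hbj := mem_support.1 (ht hj')
  have h : (ENNReal.ofReal (x i) < cap a b s t (k + 2) i x ∧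
        ENNReal.ofReal (x j) < cap a b s t (k + 2) j x) ↔
      (ENNReal.ofReal (x i) < cap a b ((s.erase i).erase j) ((t.erase i).erase j) k i x ∧
        ENNReal.ofReal (x j) < cap a b ((s.erase i).erase j) ((t.erase i).erase j) k j x) := by
    rw [lt_cap_iff hai hbi, lt_cap_iff haj hbj, lt_cap_iff hai hbi, lt_cap_iff haj hbj,
      and_and_and_comm, lt_kthSmallest_add_two_iff hi hj hij (rank_lt_top x a i)
        (rank_lt_top x a j), lt_kthSmallest_add_two_iff hi' hj' hij (rank_lt_top x b i)
        (rank_lt_top x b j), and_and_and_comm]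
  by_cases hlt : ENNReal.ofReal (x i) < cap a b s t (k + 2) i x ∧
      ENNReal.ofReal (x j) < cap a b s t (k + 2) j x
  · rw [weight_of_lt hlt.1, weight_of_lt hlt.2, weight_of_lt (h.1 hlt).1, weight_of_lt (h.1 hlt).2]
    rw [lt_cap_iff hai hbi, lt_cap_iff haj hbj] at hlt
    simp only [cap, kthSmallest_add_two_eq hi hj hij hlt.1.1 hlt.2.1,
      kthSmallest_add_two_eq hi' hj' hij hlt.1.2 hlt.2.2]
  · have zero (p q : ℝ≥0∞) (hn : ¬ (ENNReal.ofReal (x i) < p ∧ ENNReal.ofReal (x j) < q)) :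
        weight (ENNReal.ofReal (x i)) p * weight (ENNReal.ofReal (x j)) q = 0 := by
      rcases not_and_or.1 hn with hn | hn <;> simp [weight_of_not_lt hn]
    rw [zero _ _ hlt, zero _ _ (h.not.1 hlt)]

lemma lintegral_weight_cap (hs : s ⊆ support a) (ht : t ⊆ support b) (hi : i ∈ s) (hi' : i ∈ t)
    (hk : 1 ≤ k) :
    ∫⁻ x : Fin n → unitInterval,
      weight (ENNReal.ofReal (x i)) (cap a b s t (k + 1) i x) = 1 := by
  have h := lintegral_mul_weight i (φ := fun _ => 1) (T := cap a b (s.erase i) (t.erase i) k i)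
    measurable_const measurable_cap (fun _ _ => rfl)
    (cap_update (Finset.notMem_erase i s) (Finset.notMem_erase i t))
    (ae_cap_pos ((Finset.erase_subset i s).trans hs) ((Finset.erase_subset i t).trans ht)
      (mem_support.1 (hs hi)) (mem_support.1 (ht hi')) hk)
  simpa [weight_cap_succ hs ht hi hi'] using h

lemma lintegral_weight_mul_weight_cap (hs : s ⊆ support a) (ht : t ⊆ support b)
    (hi : i ∈ s) (hi' : i ∈ t) (hj : j ∈ s) (hj' : j ∈ t) (hij : i ≠ j) (hk : 1 ≤ k) :
    ∫⁻ x : Fin n → unitInterval,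
      weight (ENNReal.ofReal (x i)) (cap a b s t (k + 2) i x) *
        weight (ENNReal.ofReal (x j)) (cap a b s t (k + 2) j x) = 1 := by
  simp only [weight_mul_weight_cap_add_two hs ht hi hi' hj hj' hij]
  set s' := (s.erase i).erase j with hs'
  set t' := (t.erase i).erase j with ht'
  have his : i ∉ s' := by simp [hs']
  have hit : i ∉ t' := by simp [ht']
  have hjs : j ∉ s' := by simp [hs']
  have hjt : j ∉ t' := by simp [ht']
  have hsub : s' ⊆ support a :=
    ((Finset.erase_subset _ _).trans (Finset.erase_subset _ _)).trans hs
  have htub : t' ⊆ support b :=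
    ((Finset.erase_subset _ _).trans (Finset.erase_subset _ _)).trans ht
  -- After both deletions the weight at `i` is free of `x j`, so it serves as `φ`.
  have h1 := lintegral_mul_weight j (T := cap a b s' t' k j)
    (φ := fun x => weight (ENNReal.ofReal (x i)) (cap a b s' t' k i x))
    (by fun_prop) measurable_cap
    (fun x u => by simp only [cap_update hjs hjt, Function.update_of_ne hij])
    (cap_update hjs hjt)
    (ae_cap_pos hsub htub (mem_support.1 (hs hj)) (mem_support.1 (ht hj')) hk)
  have h2 := lintegral_mul_weight i (φ := fun _ => 1) (T := cap a b s' t' k i)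
    measurable_const measurable_cap (fun _ _ => rfl) (cap_update his hit)
    (ae_cap_pos hsub htub (mem_support.1 (hs hi)) (mem_support.1 (ht hi')) hk)
  rw [h1]
  simpa using h2

lemma measurable_inv_kthSmallest (s : Finset (Fin n)) (a : EuclideanSpace ℝ (Fin n)) (k : ℕ) :
    Measurable fun x : Fin n → unitInterval => (kthSmallest s (rank x a) k)⁻¹ :=
  measurable_inv.comp (measurable_kthSmallest s (measurable_rank a) k)

/-- Take both vectors equal to `a`. The weighted sum of the `a j ^ 2` has mean equal to the right
side, and almost surely the `k` kept terms contribute at least `τ⁻¹` each. -/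
lemma lintegral_inv_kthSmallest_le (hs : s ⊆ support a) (hk : 1 ≤ k) :
    k * ∫⁻ x : Fin n → unitInterval, (kthSmallest s (rank x a) (k + 1))⁻¹ ≤
      ∑ j ∈ s, ENNReal.ofReal (a j ^ 2) := by
  have h1 : ∑ j ∈ s, ENNReal.ofReal (a j ^ 2) =
      ∫⁻ x : Fin n → unitInterval, ∑ j ∈ s, ENNReal.ofReal (a j ^ 2) *
        weight (ENNReal.ofReal (x j)) (cap a a s s (k + 1) j x) := by
    rw [lintegral_finsetSum _ fun j _ => by fun_prop]
    refine Finset.sum_congr rfl fun j hj => ?_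
    rw [lintegral_const_mul _ (by fun_prop), lintegral_weight_cap hs hs hj hj hk, mul_one]
  rw [h1, ← lintegral_const_mul _ (measurable_inv_kthSmallest s a _)]
  refine lintegral_mono_ae ?_
  filter_upwards [ae_injOn_rank a] with x hx
  set τ := kthSmallest s (rank x a) (k + 1) with hτ
  rcases lt_or_ge s.card (k + 1) with hc | hc
  -- Here `τ = ∞`, so the left side is zero.
  · simp [hτ, kthSmallest_eq_top hc]
  have hcard := card_lt_kthSmallest_eq (hx.mono (Finset.coe_subset.2 hs))
    (fun i _ => rank_lt_top x a i) (by omega : k ≤ s.card)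
  rw [← hτ] at hcard
  calc k * τ⁻¹ = ∑ j ∈ s.filter fun i => rank x a i < τ, τ⁻¹ := by
        rw [Finset.sum_const, hcard, nsmul_eq_mul]
    _ ≤ ∑ j ∈ s.filter fun i => rank x a i < τ, ENNReal.ofReal (a j ^ 2) *
        weight (ENNReal.ofReal (x j)) (cap a a s s (k + 1) j x) := by
        refine Finset.sum_le_sum fun j hj => ?_
        obtain ⟨hjs, hjτ⟩ := Finset.mem_filter.1 hj
        have haj := mem_support.1 (hs hjs)
        have hpos : ENNReal.ofReal (a j ^ 2) ≠ 0 := by simpa [sq_pos_iff] using haj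
        rw [weight_of_lt ((lt_cap_iff haj haj x).2 ⟨hjτ, hjτ⟩), cap, min_self, ← hτ]
        calc τ⁻¹ = ENNReal.ofReal (a j ^ 2) * (ENNReal.ofReal (a j ^ 2) * τ)⁻¹ := by
              rw [ENNReal.mul_inv (Or.inl hpos) (Or.inl ENNReal.ofReal_ne_top), ← mul_assoc,
                ENNReal.mul_inv_cancel hpos ENNReal.ofReal_ne_top, one_mul]
          _ ≤ _ := by gcongr; exact min_le_right _ _
    _ ≤ _ := Finset.sum_le_sum_of_subset (Finset.filter_subset _ _)

/-- One factor of the square becomes a function free of `x i`, and the other integrates to 1. From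
level `k + 2`, deleting `i` costs one unit and bounding the inverse threshold another, hence the
factor `k`. -/
lemma lintegral_weight_cap_sq_le (hi : i ∈ support a) (hi' : i ∈ support b) (hk : 1 ≤ k) :
    k * ∫⁻ x : Fin n → unitInterval,
      weight (ENNReal.ofReal (x i)) (cap a b (support a) (support b) (k + 2) i x) ^ 2 ≤
      k + ENNReal.ofReal (‖a‖ ^ 2 / a i ^ 2) + ENNReal.ofReal (‖b‖ ^ 2 / b i ^ 2) := by
  have inv_bound (c : EuclideanSpace ℝ (Fin n)) (hc : i ∈ support c) :
      k * ∫⁻ x : Fin n → unitInterval, (ENNReal.ofReal (c i ^ 2) *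
        kthSmallest ((support c).erase i) (rank x c) (k + 1))⁻¹ ≤
      ENNReal.ofReal (‖c‖ ^ 2 / c i ^ 2) := by
    have hci : 0 < c i ^ 2 := by have := mem_support.1 hc; positivity
    have h0 : ENNReal.ofReal (c i ^ 2) ≠ 0 := (ENNReal.ofReal_pos.2 hci).ne'
    have h1 := lintegral_inv_kthSmallest_le (Finset.erase_subset i (support c)) hk
    have h2 : ∑ j ∈ (support c).erase i, ENNReal.ofReal (c j ^ 2) ≤ ENNReal.ofReal (‖c‖ ^ 2) := by
      rw [EuclideanSpace.real_norm_sq_eq, ENNReal.ofReal_sum_of_nonneg fun _ _ => sq_nonneg _]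
      exact Finset.sum_le_sum_of_subset (Finset.subset_univ _)
    simp_rw [ENNReal.mul_inv (Or.inl h0) (Or.inl ENNReal.ofReal_ne_top)]
    rw [lintegral_const_mul _ (measurable_inv_kthSmallest _ c _), mul_left_comm,
      ENNReal.ofReal_div_of_pos hci, mul_comm, ENNReal.div_eq_inv_mul, mul_comm]
    gcongr
    exact h1.trans h2
  set A := fun x : Fin n → unitInterval => ENNReal.ofReal (a i ^ 2) *
        kthSmallest ((support a).erase i) (rank x a) (k + 1) with hA
  set B := fun x : Fin n → unitInterval => ENNReal.ofReal (b i ^ 2) *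
        kthSmallest ((support b).erase i) (rank x b) (k + 1) with hB
  have hAm : Measurable A := (measurable_kthSmallest _ (measurable_rank a) _).const_mul _
  have hBm : Measurable B := (measurable_kthSmallest _ (measurable_rank b) _).const_mul _
  have hT : cap a b ((support a).erase i) ((support b).erase i) (k + 1) i =
      fun x => min (A x) (B x) := rfl
  have hsq (x : Fin n → unitInterval) :
      weight (ENNReal.ofReal (x i)) (cap a b (support a) (support b) (k + 2) i x) ^ 2 =
        (min 1 (min (A x) (B x)))⁻¹ * weight (ENNReal.ofReal (x i)) (min (A x) (B x)) := by
    rw [weight_cap_succ subset_rfl subset_rfl hi hi', hT, sq]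
    by_cases h : ENNReal.ofReal (x i) < min (A x) (B x)
    · rw [weight_of_lt h]
    · simp only [weight_of_not_lt h, mul_zero]
  have hup := cap_update (a := a) (b := b) (k := k + 1) (i := i)
    (Finset.notMem_erase i (support a)) (Finset.notMem_erase i (support b))
  rw [hT] at hup
  have hint : ∫⁻ x : Fin n → unitInterval,
      weight (ENNReal.ofReal (x i)) (cap a b (support a) (support b) (k + 2) i x) ^ 2 =
      ∫⁻ x, (min 1 (min (A x) (B x)))⁻¹ := by
    simp_rw [hsq]
    refine lintegral_mul_weight i (φ := fun x => (min 1 (min (A x) (B x)))⁻¹)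
      (T := fun x => min (A x) (B x)) (by fun_prop) (by fun_prop)
      (fun x u => by simp only [hup]) hup ?_
    have := ae_cap_pos (a := a) (b := b) (i := i) (k := k + 1) (Finset.erase_subset i (support a))
      (Finset.erase_subset i (support b)) (mem_support.1 hi) (mem_support.1 hi') (by omega)
    rwa [hT] at this
  rw [hint]
  calc k * ∫⁻ x, (min 1 (min (A x) (B x)))⁻¹
      ≤ k * ∫⁻ x, (1 + (A x)⁻¹ + (B x)⁻¹) := by
        gcongr with x
        rcases min_choice 1 (min (A x) (B x)) with h | h <;> rw [h]
        · rw [inv_one, add_assoc]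
          exact le_self_add
        · rcases min_choice (A x) (B x) with h | h <;> rw [h]
          · exact le_add_self.trans le_self_add
          · exact le_add_self
    _ = k + (k * ∫⁻ x, (A x)⁻¹) + (k * ∫⁻ x, (B x)⁻¹) := by
        rw [lintegral_add_right _ (by fun_prop), lintegral_add_right _ (by fun_prop),
          lintegral_one, measure_univ, mul_add, mul_add, mul_one]
    _ ≤ _ := add_le_add (add_le_add le_rfl (inv_bound a hi)) (inv_bound b hi')

end Cap

/-! ### From the sketches to a weighted sum -/

lemma mem_sketch_K {x : Fin n → unitInterval} {m : ℕ} {a : EuclideanSpace ℝ (Fin n)} {i : Fin n} :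
    i ∈ (sketch x m a).K ↔
      i ∈ support a ∧ rank x a i < kthSmallest (support a) (rank x a) (m + 1) :=
  Finset.mem_filter

/-- Indices not kept in both sketches have weight zero, so the sum can run over a fixed, non-random
set. -/
lemma estimate_sketch (x : Fin n → unitInterval) (m : ℕ) (a b : EuclideanSpace ℝ (Fin n)) :
    estimate (sketch x m a) (sketch x m b) =
      ∑ i ∈ support a ∩ support b, a i * b i *
        (weight (ENNReal.ofReal (x i)) (cap a b (support a) (support b) (m + 1) i x)).toReal := by
  have h1 : estimate (sketch x m a) (sketch x m b) =
      ∑ i ∈ (sketch x m a).K ∩ (sketch x m b).K, a i * b i /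
        (min 1 (cap a b (support a) (support b) (m + 1) i x)).toReal :=
    Finset.sum_coe_sort ((sketch x m a).K ∩ (sketch x m b).K) fun i => a i * b i /
        (min 1 (cap a b (support a) (support b) (m + 1) i x)).toReal
  have hlt (i : Fin n) (hi : i ∈ support a ∩ support b) :
      ENNReal.ofReal (x i) < cap a b (support a) (support b) (m + 1) i x ↔
        i ∈ (sketch x m a).K ∩ (sketch x m b).K := by
    obtain ⟨ha, hb⟩ := Finset.mem_inter.1 hi
    rw [lt_cap_iff (mem_support.1 ha) (mem_support.1 hb)]
    rw [Finset.mem_inter, mem_sketch_K, mem_sketch_K, and_iff_right ha, and_iff_right hb]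
  have hsub : (sketch x m a).K ∩ (sketch x m b).K ⊆ support a ∩ support b :=
    Finset.inter_subset_inter (Finset.filter_subset _ _) (Finset.filter_subset _ _)
  rw [h1, ← Finset.sum_subset hsub]
  · refine Finset.sum_congr rfl fun i hi => ?_
    rw [weight_of_lt ((hlt i (hsub hi)).2 hi), ENNReal.toReal_inv, div_eq_mul_inv]
  · intro i hi hi'
    rw [weight_of_not_lt ((hlt i hi).not.2 hi'), ENNReal.toReal_zero, mul_zero]

lemma sketch_size_le (x : Fin n → unitInterval) (m : ℕ) (a : EuclideanSpace ℝ (Fin n)) :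
    (sketch x m a).size ≤ m :=
  card_lt_kthSmallest_le (support a) (rank x a) m

lemma ae_sketch_size_eq {m : ℕ} {a : EuclideanSpace ℝ (Fin n)} (hm : m ≤ (support a).card) :
    ∀ᵐ x : Fin n → unitInterval, (sketch x m a).size = m := by
  filter_upwards [ae_injOn_rank a] with x hx
  exact card_lt_kthSmallest_eq hx (fun i _ => rank_lt_top x a i) hm

lemma norm_restrictTo_sq (a : EuclideanSpace ℝ (Fin n)) (I : Finset (Fin n)) :
    ‖restrictTo a I‖ ^ 2 = ∑ i ∈ I, a i ^ 2 := by
  simp [EuclideanSpace.real_norm_sq_eq, restrictTo, ite_pow, Finset.sum_ite_mem]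

lemma sum_inter_support_mul (a b : EuclideanSpace ℝ (Fin n)) :
    ∑ i ∈ support a ∩ support b, a i * b i = inner ℝ a b := by
  rw [PiLp.inner_apply, Finset.sum_subset (Finset.subset_univ _)]
  · exact Finset.sum_congr rfl fun i _ => by simp [mul_comm]
  · intro i _ hi
    rw [Finset.mem_inter, mem_support, mem_support, not_and_or, not_not, not_not] at hi
    rcases hi with h | h <;> simp [h]

/-- The factor that multiplies `a i * b i` in the estimate from two sketches of size `m`. -/
noncomputable def coeff (a b : EuclideanSpace ℝ (Fin n)) (m : ℕ) (i : Fin n)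
    (x : Fin n → unitInterval) : ℝ :=
  (weight (ENNReal.ofReal (x i)) (cap a b (support a) (support b) (m + 1) i x)).toReal

/-! ### Real-valued coefficients: mean, covariance, variance -/

section Coeff

variable {a b : EuclideanSpace ℝ (Fin n)} {m : ℕ} {i j : Fin n}

@[fun_prop]
lemma measurable_coeff : Measurable (coeff a b m i) := by
  unfold coeff
  fun_prop

/-- The weight has finite integral, so it is almost surely finite and `toReal` loses nothing. -/
lemma ofReal_coeff (ha : i ∈ support a) (hb : i ∈ support b) (hm : 1 ≤ m) :
    (fun x => ENNReal.ofReal (coeff a b m i x)) =ᵐ[volume] fun x =>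
      weight (ENNReal.ofReal (x i)) (cap a b (support a) (support b) (m + 1) i x) := by
  have h := ae_lt_top (μ := (volume : Measure (Fin n → unitInterval)))
    (f := fun x => weight (ENNReal.ofReal (x i)) (cap a b (support a) (support b) (m + 1) i x))
    (by fun_prop)
    (by rw [lintegral_weight_cap subset_rfl subset_rfl ha hb hm]; exact ENNReal.one_ne_top)
  filter_upwards [h] with x hx
  exact ENNReal.ofReal_toReal hx.ne

lemma coeff_nonneg (x : Fin n → unitInterval) : 0 ≤ coeff a b m i x := ENNReal.toReal_nonneg

lemma lintegral_ofReal_coeff (ha : i ∈ support a) (hb : i ∈ support b) (hm : 1 ≤ m) :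
    ∫⁻ x, ENNReal.ofReal (coeff a b m i x) = 1 := by
  rw [lintegral_congr_ae (ofReal_coeff ha hb hm),
    lintegral_weight_cap subset_rfl subset_rfl ha hb hm]

lemma integrable_coeff (ha : i ∈ support a) (hb : i ∈ support b) (hm : 1 ≤ m) :
    Integrable (coeff a b m i) := by
  refine (lintegral_ofReal_ne_top_iff_integrable measurable_coeff.aestronglyMeasurable
    (ae_of_all _ coeff_nonneg)).1 ?_
  rw [lintegral_ofReal_coeff ha hb hm]
  exact ENNReal.one_ne_top

lemma integral_coeff (ha : i ∈ support a) (hb : i ∈ support b) (hm : 1 ≤ m) :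
    ∫ x, coeff a b m i x = 1 := by
  rw [integral_eq_lintegral_of_nonneg_ae (ae_of_all _ coeff_nonneg)
    measurable_coeff.aestronglyMeasurable, lintegral_ofReal_coeff ha hb hm, ENNReal.toReal_one]

lemma integral_coeff_mul_coeff (ha : i ∈ support a) (hb : i ∈ support b) (ha' : j ∈ support a)
    (hb' : j ∈ support b) (hij : i ≠ j) (hm : 2 ≤ m) :
    ∫ x, coeff a b m i x * coeff a b m j x = 1 := by
  obtain ⟨k, rfl⟩ : ∃ k, m = k + 1 := ⟨m - 1, by omega⟩
  rw [integral_eq_lintegral_of_nonneg_ae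
    (ae_of_all _ fun x => mul_nonneg (coeff_nonneg x) (coeff_nonneg x))
    (measurable_coeff.mul measurable_coeff).aestronglyMeasurable]
  simp_rw [ENNReal.ofReal_mul (coeff_nonneg _)]
  rw [← ENNReal.toReal_one, ← lintegral_weight_mul_weight_cap subset_rfl subset_rfl ha hb ha' hb'
    hij (by omega : 1 ≤ k)]
  exact congrArg _ (lintegral_congr_ae
    ((ofReal_coeff ha hb (by omega)).mul (ofReal_coeff ha' hb' (by omega))))

lemma lintegral_ofReal_coeff_sq_le (ha : i ∈ support a) (hb : i ∈ support b) (hm : 2 ≤ m) :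
    ∫⁻ x, ENNReal.ofReal (coeff a b m i x ^ 2) ≤ ENNReal.ofReal
      (1 + (‖a‖ ^ 2 / a i ^ 2 + ‖b‖ ^ 2 / b i ^ 2) / ((m : ℝ) - 1)) := by
  -- This `k` is the `m - 1` of the final bound; `2 ≤ m` makes it positive.
  obtain ⟨k, rfl⟩ : ∃ k, m = k + 1 := ⟨m - 1, by omega⟩
  have hk : (0 : ℝ) < k := by exact_mod_cast (by omega : 0 < k)
  simp_rw [ENNReal.ofReal_pow (coeff_nonneg _)]
  have h := lintegral_weight_cap_sq_le ha hb (by omega : 1 ≤ k)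
  have e : ENNReal.ofReal (1 + (‖a‖ ^ 2 / a i ^ 2 + ‖b‖ ^ 2 / b i ^ 2) / (((k + 1 : ℕ) : ℝ) - 1)) =
      (k + ENNReal.ofReal (‖a‖ ^ 2 / a i ^ 2) + ENNReal.ofReal (‖b‖ ^ 2 / b i ^ 2)) / k := by
    rw [← ENNReal.ofReal_natCast k, ← ENNReal.ofReal_add hk.le (by positivity),
      ← ENNReal.ofReal_add (by positivity) (by positivity), ← ENNReal.ofReal_div_of_pos hk]
    congr 1
    push_cast
    rw [add_sub_cancel_right]
    field_simp
    ring
  rw [e, ENNReal.le_div_iff_mul_le (by simp; omega) (by simp), mul_comm]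
  refine le_of_eq_of_le (congrArg _ (lintegral_congr_ae ?_)) h
  exact (ofReal_coeff ha hb (by omega : 1 ≤ k + 1)).pow_const 2

lemma memLp_coeff (ha : i ∈ support a) (hb : i ∈ support b) (hm : 2 ≤ m) :
    MemLp (coeff a b m i) 2 := by
  refine (memLp_two_iff_integrable_sq measurable_coeff.aestronglyMeasurable).2 ?_
  refine (lintegral_ofReal_ne_top_iff_integrable
    (measurable_coeff.pow_const 2).aestronglyMeasurable
    (ae_of_all _ fun _ => sq_nonneg _)).1 ?_
  exact ((lintegral_ofReal_coeff_sq_le ha hb hm).trans_lt ENNReal.ofReal_lt_top).ne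

lemma covariance_coeff_of_ne (ha : i ∈ support a) (hb : i ∈ support b) (ha' : j ∈ support a)
    (hb' : j ∈ support b) (hij : i ≠ j) (hm : 2 ≤ m) :
    cov[coeff a b m i, coeff a b m j; volume] = 0 := by
  rw [covariance_eq_sub (memLp_coeff ha hb hm) (memLp_coeff ha' hb' hm)]
  simp only [Pi.mul_apply]
  rw [integral_coeff_mul_coeff ha hb ha' hb' hij hm, integral_coeff ha hb (by omega),
    integral_coeff ha' hb' (by omega)]
  norm_num

lemma variance_coeff_le (ha : i ∈ support a) (hb : i ∈ support b) (hm : 2 ≤ m) :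
    variance (coeff a b m i) volume ≤ (‖a‖ ^ 2 / a i ^ 2 + ‖b‖ ^ 2 / b i ^ 2) / ((m : ℝ) - 1) := by
  have hm' : (0 : ℝ) < (m : ℝ) - 1 := by
    have : (2 : ℝ) ≤ m := by exact_mod_cast hm
    linarith
  rw [variance_eq_sub (memLp_coeff ha hb hm), integral_coeff ha hb (by omega)]
  simp only [Pi.pow_apply]
  rw [integral_eq_lintegral_of_nonneg_ae (ae_of_all _ fun _ => sq_nonneg _)
    (measurable_coeff.pow_const 2).aestronglyMeasurable]
  have := ENNReal.toReal_le_of_le_ofReal (by positivity) (lintegral_ofReal_coeff_sq_le ha hb hm)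
  linarith

end Coeff

/-- The estimate from two sketches of size `m`, as a function of the hash values. -/
noncomputable def estimator (a b : EuclideanSpace ℝ (Fin n)) (m : ℕ)
    (x : Fin n → unitInterval) : ℝ :=
  ∑ i ∈ support a ∩ support b, a i * b i * coeff a b m i x

/-! ### Mean and variance of the estimator -/

section Estimator

variable {a b : EuclideanSpace ℝ (Fin n)} {m : ℕ}

@[fun_prop]
lemma measurable_estimator : Measurable (estimator a b m) := by
  unfold estimator
  fun_prop

lemma integrable_estimator (hm : 1 ≤ m) : Integrable (estimator a b m) := by
  refine integrable_finsetSum _ fun i hi => ?_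
  obtain ⟨ha, hb⟩ := Finset.mem_inter.1 hi
  exact (integrable_coeff ha hb hm).const_mul _

lemma integral_estimator (hm : 1 ≤ m) : ∫ x, estimator a b m x = inner ℝ a b := by
  unfold estimator
  rw [integral_finsetSum, ← sum_inter_support_mul]
  · refine Finset.sum_congr rfl fun i hi => ?_
    obtain ⟨ha, hb⟩ := Finset.mem_inter.1 hi
    rw [integral_const_mul, integral_coeff ha hb hm, mul_one]
  · intro i hi
    obtain ⟨ha, hb⟩ := Finset.mem_inter.1 hi
    exact (integrable_coeff ha hb hm).const_mul _

lemma memLp_estimator (hm : 2 ≤ m) : MemLp (estimator a b m) 2 := by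
  refine memLp_finsetSum _ fun i hi => ?_
  obtain ⟨ha, hb⟩ := Finset.mem_inter.1 hi
  exact (memLp_coeff ha hb hm).const_mul _

lemma variance_estimator (hm : 2 ≤ m) :
    variance (estimator a b m) volume =
      ∑ i ∈ support a ∩ support b, (a i * b i) ^ 2 * variance (coeff a b m i) volume := by
  unfold estimator
  rw [variance_fun_sum']
  · refine Finset.sum_congr rfl fun i hi => ?_
    obtain ⟨ha, hb⟩ := Finset.mem_inter.1 hi
    rw [Finset.sum_eq_single_of_mem i hi]
    · rw [covariance_self (by fun_prop), variance_const_mul]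
    · intro j hj hji
      obtain ⟨ha', hb'⟩ := Finset.mem_inter.1 hj
      rw [covariance_const_mul_left, covariance_const_mul_right,
        covariance_coeff_of_ne ha hb ha' hb' hji.symm hm, mul_zero, mul_zero]
  · intro i hi
    obtain ⟨ha, hb⟩ := Finset.mem_inter.1 hi
    exact (memLp_coeff ha hb hm).const_mul _

lemma variance_estimator_le (hm : 2 ≤ m) :
    variance (estimator a b m) volume ≤ 2 / ((m : ℝ) - 1) *
      max (‖restrictTo a (support a ∩ support b)‖ ^ 2 * ‖b‖ ^ 2)
        (‖a‖ ^ 2 * ‖restrictTo b (support a ∩ support b)‖ ^ 2) := by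
  have hm' : (0 : ℝ) < (m : ℝ) - 1 := by
    have : (2 : ℝ) ≤ m := by exact_mod_cast hm
    linarith
  have h1 : variance (estimator a b m) volume ≤ ∑ i ∈ support a ∩ support b,
      (‖a‖ ^ 2 * b i ^ 2 + a i ^ 2 * ‖b‖ ^ 2) / ((m : ℝ) - 1) := by
    rw [variance_estimator hm]
    refine Finset.sum_le_sum fun i hi => ?_
    obtain ⟨ha, hb⟩ := Finset.mem_inter.1 hi
    have ha0 := mem_support.1 ha
    have hb0 := mem_support.1 hb
    calc (a i * b i) ^ 2 * variance (coeff a b m i) volume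
        ≤ (a i * b i) ^ 2 * ((‖a‖ ^ 2 / a i ^ 2 + ‖b‖ ^ 2 / b i ^ 2) / ((m : ℝ) - 1)) := by
          gcongr
          exact variance_coeff_le ha hb hm
      -- The factor `(a i * b i) ^ 2` cancels both denominators, as `i` lies in both supports.
      _ = _ := by field_simp
  rw [← Finset.sum_div, Finset.sum_add_distrib, ← Finset.mul_sum, ← Finset.sum_mul,
    ← norm_restrictTo_sq, ← norm_restrictTo_sq] at h1
  refine h1.trans ?_
  rw [div_mul_eq_mul_div, div_le_div_iff_of_pos_right hm', two_mul, add_comm]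
  -- The constant 2 arises from bounding a sum of two terms by twice their maximum.
  exact add_le_add (le_max_left _ _) (le_max_right _ _)

end Estimator

end PrioritySampling

theorem theorem2 {n : ℕ} {Ω : Type*} [MeasurableSpace Ω] (P : Measure Ω) [IsProbabilityMeasure P]
    (h : Ω → Fin n → unitInterval)
    (hh : HasLaw h (volume : Measure (Fin n → unitInterval)) P)
    (a b : EuclideanSpace ℝ (Fin n)) (m : ℕ) (hm : 1 ≤ m) :
    let Sa : Ω → PrioritySampling.Sketch n := fun ω => PrioritySampling.sketch (h ω) m a
    let Sb : Ω → PrioritySampling.Sketch n := fun ω => PrioritySampling.sketch (h ω) m b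
    let W : Ω → ℝ := fun ω => PrioritySampling.estimate (Sa ω) (Sb ω)
    let I : Finset (Fin n) := PrioritySampling.support a ∩ PrioritySampling.support b
    (Integrable W P ∧ ∫ ω, W ω ∂P = inner ℝ a b) ∧
    (2 ≤ m → MemLp W 2 P ∧
      variance W P ≤ 2 / ((m : ℝ) - 1) *
        max (‖PrioritySampling.restrictTo a I‖ ^ 2 * ‖b‖ ^ 2)
          (‖a‖ ^ 2 * ‖PrioritySampling.restrictTo b I‖ ^ 2)) ∧
    (∀ ω, (Sa ω).size ≤ m ∧ (Sb ω).size ≤ m) ∧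
    (m ≤ (PrioritySampling.support a).card → ∀ᵐ ω ∂P, (Sa ω).size = m) ∧
    (m ≤ (PrioritySampling.support b).card → ∀ᵐ ω ∂P, (Sb ω).size = m) := by
  intro Sa Sb W I
  -- `W` factors through `h`, so its moments depend only on the law of `h`.
  have hW : W = PrioritySampling.estimator a b m ∘ h :=
    funext fun ω => PrioritySampling.estimate_sketch (h ω) m a b
  have hmeas := PrioritySampling.measurable_estimator (a := a) (b := b) (m := m)
  rw [hW]
  refine ⟨⟨?_, ?_⟩, fun hm2 => ⟨?_, ?_⟩,
    fun ω => ⟨PrioritySampling.sketch_size_le _ _ _, PrioritySampling.sketch_size_le _ _ _⟩,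
    fun ha => ?_, fun hb => ?_⟩
  · rw [← integrable_map_measure hmeas.aestronglyMeasurable hh.aemeasurable, hh.map_eq]
    exact PrioritySampling.integrable_estimator hm
  · rw [hh.integral_comp hmeas.aestronglyMeasurable, PrioritySampling.integral_estimator hm]
  · rw [← memLp_map_measure_iff hmeas.aestronglyMeasurable hh.aemeasurable, hh.map_eq]
    exact PrioritySampling.memLp_estimator hm2
  · rw [← variance_map hmeas.aemeasurable hh.aemeasurable, hh.map_eq]
    exact PrioritySampling.variance_estimator_le hm2
  · exact ae_of_ae_map hh.aemeasurable (hh.map_eq ▸ PrioritySampling.ae_sketch_size_eq ha)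
  · exact ae_of_ae_map hh.aemeasurable (hh.map_eq ▸ PrioritySampling.ae_sketch_size_eq hb)
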